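/- For a natural number $k$, let $\beta(k)$ be the least $t$ such that some DNF formula with $t \ge 1$ terms or some CNF formula with $t \ge 1$ clauses, over a finite set of Boolean variables (not all of which need to occur in the formula), has exactly $k$ satisfying assignments. Let $bl(k)$ be the number of maximal blocks of consecutive $1$s in the binary expansion of $k$, and let $\log$ denote the logarithm to base $2$. Then for every $k \ge 3$, $$\log(bl(k)+1) \;\le\; \beta(k) \;\le\; \min\left\{20\sqrt{\log k}\,\log\log k,\; bl(k)+1\right\}.$$ -/

import Mathlib

namespace ModelCounting

/-- A truth assignment to the variables `x_0, …, x_{n-1}`. -/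
abbrev Assignment (n : ℕ) := Fin n → Bool

/-- A literal over `n` variables: `(i, true)` is `x_i` and `(i, false)` is its negation. -/
abbrev Literal (n : ℕ) := Fin n × Bool

/-- The literal `l` evaluates to true under `v`. -/
def Literal.Holds {n : ℕ} (l : Literal n) (v : Assignment n) : Prop := v l.1 = l.2

/-- A formula in normal form over `n` variables is a finite set of finite sets of literals.
Read as a DNF, the inner sets are the terms (conjunctions) and the formula is their disjunction;
read as a CNF, the inner sets are the clauses (disjunctions) and the formula is their
conjunction. -/
abbrev NormalForm (n : ℕ) := Finset (Finset (Literal n))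

/-- The satisfying assignments of `F` read as a DNF. Variables that do not occur in `F` are
free. -/
def dnfSol {n : ℕ} (F : NormalForm n) : Set (Assignment n) :=
  {v | ∃ T ∈ F, ∀ l ∈ T, l.Holds v}

/-- The satisfying assignments of `F` read as a CNF. -/
def cnfSol {n : ℕ} (F : NormalForm n) : Set (Assignment n) :=
  {v | ∀ C ∈ F, ∃ l ∈ C, l.Holds v}

/-- Some DNF with exactly `t` terms, or some CNF with exactly `t` clauses, over some finite number
of variables, has exactly `k` satisfying assignments. A DNF has at least one term and a CNF at
least one clause. -/
def Generates (k t : ℕ) : Prop :=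
  ∃ (n : ℕ) (F : NormalForm n), F.Nonempty ∧ F.card = t ∧
    ((dnfSol F).ncard = k ∨ (cnfSol F).ncard = k)

/-- The minimum number of terms or clauses of a DNF or CNF with exactly `k` satisfying
assignments. -/
noncomputable def beta (k : ℕ) : ℕ := sInf {t | Generates k t}

/-- The number of maximal blocks of consecutive ones in the binary expansion of `k`: each block is
counted at its most significant position, a bit `1` whose next higher bit is `0`. -/
def blockCount (k : ℕ) : ℕ :=
  ((Finset.range k.size).filter fun i => k.testBit i = true ∧ k.testBit (i + 1) = false).card

end ModelCounting

namespace ModelCounting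

/-! Lower bound: the models of a term form a cube, of size zero or a power of two, and cubes are
closed under intersection. Inclusion–exclusion thus writes the model count of a DNF with t terms as
a signed sum of at most 2^t - 1 powers of two (`isSignedSum_inter_union`). Each summand moves the
block count by at most one (`blockCount_add_two_pow`), so bl(k) < 2^t. A CNF counts a complement;
its extra 2^n is free, since 2^n - 2^a has at most one block (`card_union_eq`).

Upper bound bl(k) + 1: a DNF is grown along the binary expansion, with a free variable for each
appended 0 and one term for each run of 1s (`IsExtendable.double`, `IsExtendable.append_ones`).

Square-root bound: in a CNF, a one-hot selector splits the models into classes, each a product of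
two simple factors (`exists_hasCnf_sum`). With p = ⌊√⌊log k⌋⌋ - 2, expanding in base 2^(p+2) with p
digits realises k by O(p) clauses. This gives 8√(log k) for k ≥ 16, where only log log k ≥ 1 is
needed of the remaining factor. -/

/-! ### Block counts under addition of powers of two -/

theorem blockCount_eq_sum {k N : ℕ} (h : k.size ≤ N) :
    blockCount k = ∑ i ∈ Finset.range N,
      if k.testBit i = true ∧ k.testBit (i + 1) = false then 1 else 0 := by
  unfold blockCount
  rw [Finset.card_filter]
  refine Finset.sum_subset (Finset.range_mono h) fun i _ hi => ?_
  have : k.testBit i = false := by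
    apply Nat.testBit_lt_two_pow
    exact Nat.size_le.1 (by simpa using hi)
  simp [this]

theorem blockCount_two_mul (x : ℕ) : blockCount (2 * x) = blockCount x := by
  have h : (2 * x).size ≤ x.size + 1 := by
    rw [Nat.size_le, pow_succ]
    have := Nat.lt_size_self x
    omega
  rw [blockCount_eq_sum h, Finset.sum_range_succ', blockCount_eq_sum le_rfl]
  simp [Nat.testBit_succ]

theorem blockCount_two_mul_add_one (x : ℕ) :
    blockCount (2 * x + 1) = blockCount x + if x % 2 = 0 then 1 else 0 := by
  have h : (2 * x + 1).size ≤ x.size + 1 := by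
    rw [Nat.size_le, pow_succ]
    have := Nat.lt_size_self x
    omega
  have h2 : (2 * x + 1) / 2 = x := by omega
  rw [blockCount_eq_sum h, Finset.sum_range_succ', blockCount_eq_sum le_rfl]
  simp only [Nat.testBit_succ, h2]
  simp [Nat.testBit_zero]

@[simp] theorem blockCount_zero : blockCount 0 = 0 := by simp [blockCount]

/-- Incrementing an even number only sets its last bit, so no block is lost; incrementing an odd one
carries, so none is created. This parity refinement is what the carry case of
`blockCount_add_two_pow` needs. -/
theorem blockCount_succ (z : ℕ) :
    blockCount (z + 1) ≤ blockCount z + (if z % 2 = 0 then 1 else 0) ∧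
      blockCount z ≤ blockCount (z + 1) + (if z % 2 = 0 then 0 else 1) := by
  induction z using Nat.strong_induction_on with
  | _ z ih =>
    obtain ⟨y, rfl | rfl⟩ := Nat.even_or_odd' z
    · rw [blockCount_two_mul, blockCount_two_mul_add_one]
      split_ifs <;> omega
    · have h := ih y (by omega)
      rw [show 2 * y + 1 + 1 = 2 * (y + 1) by ring, blockCount_two_mul,
        blockCount_two_mul_add_one]
      split_ifs at h ⊢ <;> omega

theorem blockCount_add_two_pow (i x : ℕ) :
    blockCount (x + 2 ^ i) ≤ blockCount x + 1 ∧ blockCount x ≤ blockCount (x + 2 ^ i) + 1 := by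
  induction i generalizing x with
  | zero =>
    have h := blockCount_succ x
    rw [pow_zero]
    split_ifs at h <;> omega
  | succ i ih =>
    obtain ⟨y, rfl | rfl⟩ := Nat.even_or_odd' x
    · rw [show 2 * y + 2 ^ (i + 1) = 2 * (y + 2 ^ i) by ring, blockCount_two_mul,
        blockCount_two_mul]
      exact ih y
    · rw [show 2 * y + 1 + 2 ^ (i + 1) = 2 * (y + 2 ^ i) + 1 by ring,
        blockCount_two_mul_add_one, blockCount_two_mul_add_one]
      rcases i with _ | i
      · have h := blockCount_succ y
        rw [pow_zero]
        split_ifs at h ⊢ <;> omega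
      · have h := ih y
        have : (y + 2 ^ (i + 1)) % 2 = y % 2 := by rw [pow_succ]; omega
        rw [this]
        omega

theorem blockCount_add_sum (P : List ℕ) (x : ℕ) :
    blockCount (x + (P.map (2 ^ ·)).sum) ≤ blockCount x + P.length ∧
      blockCount x ≤ blockCount (x + (P.map (2 ^ ·)).sum) + P.length := by
  induction P generalizing x with
  | nil => simp
  | cons i P ih =>
    have h1 := blockCount_add_two_pow i x
    have h2 := ih (x + 2 ^ i)
    simp only [List.map_cons, List.sum_cons, List.length_cons, ← add_assoc]
    omega

theorem blockCount_two_pow_mul (a x : ℕ) : blockCount (2 ^ a * x) = blockCount x := by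
  induction a with
  | zero => simp
  | succ a ih => rw [pow_succ', mul_assoc, blockCount_two_mul, ih]

theorem blockCount_two_pow_sub_one (c : ℕ) : blockCount (2 ^ c - 1) ≤ 1 := by
  induction c with
  | zero => simp
  | succ c ih =>
    have hc : 1 ≤ 2 ^ c := Nat.one_le_two_pow
    rw [show 2 ^ (c + 1) - 1 = 2 * (2 ^ c - 1) + 1 by rw [pow_succ]; omega,
      blockCount_two_mul_add_one]
    rcases c with _ | c
    · simp
    · have : (2 ^ (c + 1) - 1) % 2 ≠ 0 := by
        rw [pow_succ] at hc ⊢; omega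
      simpa [this] using ih

theorem blockCount_two_pow_sub_two_pow {a n : ℕ} (h : a ≤ n) :
    blockCount (2 ^ n - 2 ^ a) ≤ 1 := by
  obtain ⟨c, rfl⟩ := Nat.exists_eq_add_of_le h
  rw [show 2 ^ (a + c) - 2 ^ a = 2 ^ a * (2 ^ c - 1) by rw [pow_add, Nat.mul_sub, mul_one],
    blockCount_two_pow_mul]
  exact blockCount_two_pow_sub_one c

theorem blockCount_two_pow (n : ℕ) : blockCount (2 ^ n) = 1 := by
  have := blockCount_two_pow_mul n 1
  rw [mul_one] at this
  rw [this]
  simpa using blockCount_two_mul_add_one 0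

/-! ### Signed sums, cubes and the lower bound -/

/-- `x` is a signed sum of at most `m` powers of two. -/
def IsSignedSum (m : ℕ) (x : ℤ) : Prop :=
  ∃ P N : List ℕ, P.length + N.length ≤ m ∧
    x = ((P.map (2 ^ ·)).sum : ℕ) - ((N.map (2 ^ ·)).sum : ℕ)

theorem IsSignedSum.add {m m' : ℕ} {x y : ℤ} (hx : IsSignedSum m x) (hy : IsSignedSum m' y) :
    IsSignedSum (m + m') (x + y) := by
  obtain ⟨P, N, h, rfl⟩ := hx
  obtain ⟨P', N', h', rfl⟩ := hy
  refine ⟨P ++ P', N ++ N', by simp only [List.length_append]; omega, ?_⟩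
  simp only [List.map_append, List.sum_append]
  push_cast
  ring

theorem IsSignedSum.neg {m : ℕ} {x : ℤ} (hx : IsSignedSum m x) : IsSignedSum m (-x) := by
  obtain ⟨P, N, h, rfl⟩ := hx
  exact ⟨N, P, by omega, by ring⟩

theorem IsSignedSum.mono {m m' : ℕ} {x : ℤ} (hx : IsSignedSum m x) (h : m ≤ m') :
    IsSignedSum m' x := by
  obtain ⟨P, N, h', rfl⟩ := hx
  exact ⟨P, N, by omega, rfl⟩

theorem isSignedSum_zero : IsSignedSum 0 0 := ⟨[], [], by simp, by simp⟩

theorem isSignedSum_two_pow (a : ℕ) : IsSignedSum 1 (2 ^ a : ℕ) := ⟨[a], [], by simp, by simp⟩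

theorem IsSignedSum.blockCount_le {m k x : ℕ} (h : IsSignedSum m ((k : ℤ) - x)) :
    blockCount k ≤ blockCount x + m := by
  obtain ⟨P, N, h, hk⟩ := h
  have h1 := blockCount_add_sum P x
  have h2 := blockCount_add_sum N k
  have : k + (N.map (2 ^ ·)).sum = x + (P.map (2 ^ ·)).sum := by omega
  rw [this] at h2
  omega

/-- The assignments satisfying every literal of `T`. -/
def cube {n : ℕ} (T : Finset (Literal n)) : Finset (Assignment n) :=
  Fintype.piFinset fun i => {b | ∀ l ∈ T, l.1 = i → b = l.2}

theorem mem_cube {n : ℕ} {T : Finset (Literal n)} {v : Assignment n} :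
    v ∈ cube T ↔ ∀ l ∈ T, l.Holds v := by
  simp only [cube, Fintype.mem_piFinset, Finset.mem_filter, Finset.mem_univ, true_and,
    Literal.Holds]
  exact ⟨fun h l hl => h _ l hl rfl, fun h i l hl hi => hi ▸ h l hl⟩

theorem prod_eq_zero_or_two_pow {ι : Type*} (s : Finset ι) (f : ι → ℕ) (hf : ∀ i, f i ≤ 2) :
    ∏ i ∈ s, f i = 0 ∨ ∃ a ≤ s.card, ∏ i ∈ s, f i = 2 ^ a := by
  classical
  induction s using Finset.induction_on with
  | empty => exact Or.inr ⟨0, by simp, by simp⟩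
  | insert i s hi ih =>
    rw [Finset.prod_insert hi, Finset.card_insert_of_notMem hi]
    rcases ih with h | ⟨a, ha, h⟩
    · simp [h]
    · rw [h]
      have := hf i
      interval_cases f i
      · simp
      · exact Or.inr ⟨a, by omega, by simp⟩
      · exact Or.inr ⟨a + 1, by omega, by ring⟩

theorem card_cube {n : ℕ} (T : Finset (Literal n)) :
    (cube T).card = 0 ∨ ∃ a ≤ n, (cube T).card = 2 ^ a := by
  rw [cube, Fintype.card_piFinset]
  simpa using prod_eq_zero_or_two_pow Finset.univ
    (fun i => Finset.card (Finset.univ.filter fun b => ∀ l ∈ T, l.1 = i → b = l.2))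
    fun i => Finset.card_le_univ _

theorem cube_union {n : ℕ} (T T' : Finset (Literal n)) : cube (T ∪ T') = cube T ∩ cube T' := by
  ext v
  simp only [Finset.mem_inter, mem_cube, Finset.mem_union]
  exact ⟨fun h => ⟨fun l hl => h l (.inl hl), fun l hl => h l (.inr hl)⟩,
    fun h l hl => hl.elim (h.1 l) (h.2 l)⟩

theorem isSignedSum_card_cube {n : ℕ} (T : Finset (Literal n)) :
    IsSignedSum 1 ((cube T).card : ℤ) := by
  rcases card_cube T with h | ⟨a, -, h⟩
  · rw [h]; exact isSignedSum_zero.mono (by simp)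
  · rw [h]; exact isSignedSum_two_pow a

/-- The cube `T` is arbitrary so that the induction closes: adding `S` to the union produces the
same problem for `T` and for `T ∪ S`, plus one cube, and 2(2^m - 1) + 1 = 2^(m+1) - 1. -/
theorem isSignedSum_inter_union {n : ℕ} (F : Finset (Finset (Literal n)))
    (T : Finset (Literal n)) :
    IsSignedSum (2 ^ F.card - 1) ((cube T ∩ F.biUnion cube).card : ℤ) := by
  induction F using Finset.induction_on generalizing T with
  | empty => simpa using isSignedSum_zero
  | insert S F hS ih =>
    have h1 := ih T
    have h2 := ih (T ∪ S)
    have h3 := isSignedSum_card_cube (T ∪ S)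
    have key := Finset.card_union_add_card_inter (cube (T ∪ S)) (cube T ∩ F.biUnion cube)
    have e1 : cube (T ∪ S) ∪ cube T ∩ F.biUnion cube =
        cube T ∩ (insert S F).biUnion cube := by
      rw [cube_union, Finset.biUnion_insert, Finset.inter_union_distrib_left]
    have e2 : cube (T ∪ S) ∩ (cube T ∩ F.biUnion cube) = cube (T ∪ S) ∩ F.biUnion cube := by
      rw [cube_union, Finset.inter_comm (cube T) (cube S), Finset.inter_assoc,
        Finset.inter_assoc, ← Finset.inter_assoc (cube T) (cube T), Finset.inter_self]
    rw [e1, e2] at key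
    have hp : 1 ≤ 2 ^ F.card := Nat.one_le_two_pow
    rw [Finset.card_insert_of_notMem hS, pow_succ]
    have := ((h3.add h1).add h2.neg).mono
      (show 1 + (2 ^ F.card - 1) + (2 ^ F.card - 1) ≤ 2 ^ F.card * 2 - 1 by omega)
    convert this using 1
    omega

/-- The size 2^a of one nonempty cube is kept apart, so that a CNF can pair it with 2^n. If there is
no such cube, the union is empty. -/
theorem card_union_eq {n : ℕ} (F : Finset (Finset (Literal n))) :
    (F.biUnion cube).card = 0 ∨
      ∃ a ≤ n, IsSignedSum (2 ^ F.card - 2) (((F.biUnion cube).card : ℤ) - (2 ^ a : ℕ)) := by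
  induction F using Finset.induction_on with
  | empty => simp
  | insert S F hS ih =>
    have h1 := isSignedSum_inter_union F ∅
    have h2 := isSignedSum_inter_union F S
    have e0 : cube (∅ : Finset (Literal n)) = Finset.univ := by
      ext v; simp [mem_cube]
    rw [e0, Finset.univ_inter] at h1
    have hp : 1 ≤ 2 ^ F.card := Nat.one_le_two_pow
    rw [Finset.card_insert_of_notMem hS, pow_succ, Finset.biUnion_insert]
    rcases card_cube S with h | ⟨a, ha, h⟩
    · rw [Finset.card_eq_zero.1 h, Finset.empty_union]
      rcases ih with ih | ⟨a, ha, ih⟩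
      · exact Or.inl ih
      · exact Or.inr ⟨a, ha, ih.mono (by omega)⟩
    · refine Or.inr ⟨a, ha, ?_⟩
      have key := Finset.card_union_add_card_inter (cube S) (F.biUnion cube)
      have := (h1.add h2.neg).mono
        (show (2 ^ F.card - 1) + (2 ^ F.card - 1) ≤ 2 ^ F.card * 2 - 2 by omega)
      convert this using 1
      omega

theorem dnfSol_eq {n : ℕ} (F : NormalForm n) : dnfSol F = ↑(F.biUnion cube) := by
  ext v
  simp [dnfSol, mem_cube]

/-- Negating every literal turns a CNF into a DNF of the complement. -/
def flipForm {n : ℕ} (F : NormalForm n) : NormalForm n :=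
  F.image fun T => T.image fun l => (l.1, !l.2)

theorem card_flipForm_le {n : ℕ} (F : NormalForm n) : (flipForm F).card ≤ F.card :=
  Finset.card_image_le

theorem cnfSol_eq {n : ℕ} (F : NormalForm n) : cnfSol F = (dnfSol (flipForm F))ᶜ := by
  ext v
  have h (b c : Bool) : b = !c ↔ ¬ b = c := by cases b <;> cases c <;> decide
  simp only [cnfSol, dnfSol, flipForm, Literal.Holds, Set.mem_ofPred_eq, Set.mem_compl_iff,
    Finset.mem_image, exists_exists_and_eq_and, forall_exists_index, and_imp,
    forall_apply_eq_imp_iff₂, h, not_exists, not_and, not_forall, not_not, exists_prop]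

theorem blockCount_lt_of_generates {k t : ℕ} (h : Generates k t) : blockCount k < 2 ^ t := by
  obtain ⟨n, F, hF, rfl, h | h⟩ := h
  · have h2 : 2 ≤ 2 ^ F.card := Nat.pow_le_pow_right (n := 2) (by norm_num) hF.card_pos
    rw [dnfSol_eq, Set.ncard_coe_finset] at h
    rcases card_union_eq F with h0 | ⟨a, -, hs⟩
    · rw [← h, h0, blockCount_zero]; omega
    · rw [h] at hs
      have := hs.blockCount_le
      rw [blockCount_two_pow] at this
      omega
  · have hG : 1 ≤ (flipForm F).card := (hF.image _).card_pos
    have h2 : 2 ≤ 2 ^ (flipForm F).card := Nat.pow_le_pow_right (n := 2) (by norm_num) hG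
    refine lt_of_lt_of_le ?_ (Nat.pow_le_pow_right (n := 2) (by norm_num) (card_flipForm_le F))
    rw [cnfSol_eq, dnfSol_eq, ← Finset.coe_compl, Set.ncard_coe_finset, Finset.card_compl] at h
    have hle := Finset.card_le_univ ((flipForm F).biUnion cube)
    simp only [Fintype.card_pi, Fintype.card_bool, Finset.prod_const, Finset.card_univ,
      Fintype.card_fin] at h hle
    rcases card_union_eq (flipForm F) with h0 | ⟨a, ha, hs⟩
    · rw [← h, h0, Nat.sub_zero, blockCount_two_pow]; omega
    · have hpa : 2 ^ a ≤ 2 ^ n := Nat.pow_le_pow_right (by norm_num) ha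
      have hs' : IsSignedSum (2 ^ (flipForm F).card - 2) ((k : ℤ) - (2 ^ n - 2 ^ a : ℕ)) := by
        convert hs.neg using 1
        omega
      have := hs'.blockCount_le
      have := blockCount_two_pow_sub_two_pow ha
      omega

/-! ### Building CNFs over arbitrary finite variable types -/

variable {α β : Type*}

/-- The predicate `P` on assignments is expressed by a single clause. -/
def IsClause (P : (α → Bool) → Prop) : Prop :=
  ∃ C : Finset (α × Bool), ∀ v, P v ↔ ∃ l ∈ C, v l.1 = l.2

/-- The predicate `P` on assignments is expressed by a CNF with at most `t` clauses. -/
def HasCnf (t : ℕ) (P : (α → Bool) → Prop) : Prop :=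
  ∃ F : Finset (Finset (α × Bool)), F.card ≤ t ∧ ∀ v, P v ↔ ∀ C ∈ F, ∃ l ∈ C, v l.1 = l.2

theorem IsClause.lit (a : α) (b : Bool) : IsClause fun v => v a = b :=
  ⟨{(a, b)}, by simp⟩

theorem IsClause.or {P Q : (α → Bool) → Prop} (hP : IsClause P) (hQ : IsClause Q) :
    IsClause fun v => P v ∨ Q v := by
  classical
  obtain ⟨C, hC⟩ := hP
  obtain ⟨D, hD⟩ := hQ
  refine ⟨C ∪ D, fun v => ?_⟩
  simp only [hC, hD, Finset.mem_union, or_and_right, exists_or]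

theorem IsClause.false : IsClause fun _ : α → Bool => False := ⟨∅, by simp⟩

theorem IsClause.exists {ι : Type*} [Fintype ι] {P : ι → (α → Bool) → Prop}
    (hP : ∀ i, IsClause (P i)) : IsClause fun v => ∃ i, P i v := by
  classical
  choose C hC using hP
  refine ⟨Finset.univ.biUnion C, fun v => ?_⟩
  simp only [hC, Finset.mem_biUnion, Finset.mem_univ, true_and]
  exact ⟨fun ⟨i, l, h, h'⟩ => ⟨l, ⟨i, h⟩, h'⟩, fun ⟨l, ⟨i, h⟩, h'⟩ => ⟨i, l, h, h'⟩⟩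

theorem IsClause.const_and {P : (α → Bool) → Prop} (c : Prop) (hP : IsClause P) :
    IsClause fun v => c ∧ P v := by
  by_cases hc : c
  · simpa [hc] using hP
  · simpa [hc] using IsClause.false

theorem IsClause.hasCnf {P : (α → Bool) → Prop} (hP : IsClause P) : HasCnf 1 P := by
  obtain ⟨C, hC⟩ := hP
  exact ⟨{C}, by simp, by simpa using hC⟩

theorem HasCnf.true : HasCnf 0 fun _ : α → Bool => True := ⟨∅, by simp⟩

theorem HasCnf.and {s t : ℕ} {P Q : (α → Bool) → Prop} (hP : HasCnf s P) (hQ : HasCnf t Q) :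
    HasCnf (s + t) fun v => P v ∧ Q v := by
  classical
  obtain ⟨F, hF, hP⟩ := hP
  obtain ⟨G, hG, hQ⟩ := hQ
  refine ⟨F ∪ G, (Finset.card_union_le _ _).trans (by omega), fun v => ?_⟩
  simp only [hP, hQ, Finset.forall_mem_union]

theorem HasCnf.forall {ι : Type*} [Fintype ι] {P : ι → (α → Bool) → Prop}
    (hP : ∀ i, IsClause (P i)) : HasCnf (Fintype.card ι) fun v => ∀ i, P i v := by
  classical
  choose C hC using hP
  refine ⟨Finset.univ.image C, Finset.card_image_le, fun v => ?_⟩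
  simp [hC]

theorem HasCnf.comap {t : ℕ} {P : (α → Bool) → Prop} (hP : HasCnf t P) (f : α → β) :
    HasCnf t fun v : β → Bool => P (v ∘ f) := by
  classical
  obtain ⟨F, hF, hP⟩ := hP
  refine ⟨F.image fun C => C.image fun l => (f l.1, l.2), Finset.card_image_le.trans hF,
    fun v => ?_⟩
  simp only [hP, Finset.mem_image, exists_exists_and_eq_and, forall_exists_index, and_imp,
    forall_apply_eq_imp_iff₂, Function.comp]

theorem HasCnf.congr {t : ℕ} {P Q : (α → Bool) → Prop} (hP : HasCnf t P)
    (h : ∀ v, Q v ↔ P v) : HasCnf t Q := by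
  obtain rfl : Q = P := funext fun v => propext (h v)
  exact hP

theorem HasCnf.mono {s t : ℕ} {P : (α → Bool) → Prop} (hP : HasCnf s P) (h : s ≤ t) :
    HasCnf t P := by
  obtain ⟨F, hF, hP⟩ := hP
  exact ⟨F, hF.trans h, hP⟩

theorem ncard_comp_equiv {γ : Type*} (e : α ≃ β) (P : (α → γ) → Prop) :
    {v : β → γ | P (v ∘ e)}.ncard = {v | P v}.ncard := by
  rw [← Set.ncard_image_of_injective _ (e.arrowCongr (Equiv.refl γ)).injective]
  congr 1
  ext v
  constructor
  · intro h
    exact ⟨v ∘ e, h, by ext; simp [Equiv.arrowCongr]⟩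
  · rintro ⟨w, hw, rfl⟩
    simpa [Equiv.arrowCongr, Function.comp_def] using hw

theorem HasCnf.exists_generates [Fintype α] {k t : ℕ} {P : (α → Bool) → Prop}
    (hP : HasCnf t P) (ht : 1 ≤ t) (hk : {v | P v}.ncard = k) : ∃ t' ≤ t, Generates k t' := by
  obtain ⟨F, hF, h⟩ := hP.comap (Fintype.equivFin α)
  rw [← ncard_comp_equiv (Fintype.equivFin α)] at hk
  rcases F.eq_empty_or_nonempty with rfl | hne
  -- `Generates` rejects the empty CNF; the DNF whose only term is empty is a tautology too.
  · refine ⟨1, ht, Fintype.card α, {∅}, by simp, by simp, Or.inl ?_⟩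
    rw [← hk]
    congr 1
    ext v
    have := h v
    simp_all [dnfSol]
  · refine ⟨_, hF, _, F, hne, rfl, Or.inr ?_⟩
    rw [← hk]
    congr 1
    ext v
    exact (h v).symm

theorem HasCnf.exists_generates_compl [Fintype α] {k t : ℕ} {P : (α → Bool) → Prop}
    (hP : HasCnf t fun v => ¬ P v) (h0 : k ≠ 0) (hk : {v | P v}.ncard = k) :
    ∃ t' ≤ t, Generates k t' := by
  obtain ⟨F, hF, h⟩ := hP.comap (Fintype.equivFin α)
  rw [← ncard_comp_equiv (Fintype.equivFin α)] at hk
  rcases F.eq_empty_or_nonempty with rfl | hne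
  · refine absurd ?_ h0
    rw [← hk, Set.ncard_eq_zero]
    ext v
    have := h v
    simp_all
  · refine ⟨_, (card_flipForm_le F).trans hF, _, flipForm F, hne.image _, rfl, Or.inl ?_⟩
    rw [← hk]
    have hc : cnfSol F = {v | P (v ∘ Fintype.equivFin α)}ᶜ := by
      ext v
      exact (h v).symm
    rw [cnfSol_eq, compl_inj_iff] at hc
    rw [hc]

/-! ### The upper bound bl(k) + 1 -/

theorem ncard_forall_true (p : α → Prop) [Fintype α] [DecidablePred p] :
    {a : α → Bool | ∀ i, p i → a i = true}.ncard =
      2 ^ (Finset.univ.filter fun i => ¬ p i).card := by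
  classical
  have : {a : α → Bool | ∀ i, p i → a i = true} =
      ↑(Fintype.piFinset fun i => if p i then {true} else (Finset.univ : Finset Bool)) := by
    ext a
    simp only [Set.mem_ofPred_eq, Finset.mem_coe, Fintype.mem_piFinset]
    refine forall_congr' fun i => ?_
    split_ifs with h <;> simp [h]
  rw [this, Set.ncard_coe_finset, Fintype.card_piFinset, Finset.card_filter,
    ← Finset.prod_pow_eq_pow_sum]
  refine Finset.prod_congr rfl fun i _ => ?_
  split_ifs <;> simp_all

/-- A DNF `P` with at most `t` terms, over `E` distinguished and some further variables, that
becomes a formula with exactly `k` models once the conjunction of the distinguished variables is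
added as a term, and that leaves some assignment of the further variables untouched. -/
def IsExtendable (E k t : ℕ) : Prop :=
  ∃ (α : Type) (_ : Fintype α) (P : (Fin E → Bool) × (α → Bool) → Prop),
    HasCnf t (fun v : Fin E ⊕ α → Bool => ¬ P (v ∘ Sum.inl, v ∘ Sum.inr)) ∧
      (∃ q, ∀ a, ¬ P (a, q)) ∧ {p | (∀ i, p.1 i = true) ∨ P p}.ncard = k

theorem isExtendable_one (E : ℕ) : IsExtendable E 1 0 := by
  refine ⟨Empty, inferInstance, fun _ => False, ?_, ⟨Empty.elim, by simp⟩, ?_⟩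
  · simpa using HasCnf.true
  · rw [Set.ncard_eq_one]
    refine ⟨(fun _ => true, Empty.elim), ?_⟩
    ext ⟨a, q⟩
    simp only [or_false, Set.mem_ofPred_eq, Set.mem_singleton_iff, Prod.mk.injEq, funext_iff]
    exact ⟨fun h => ⟨h, fun x => x.elim⟩, fun h => h.1⟩

theorem IsExtendable.mono {E k s t : ℕ} (h : IsExtendable E k s) (hst : s ≤ t) :
    IsExtendable E k t := by
  obtain ⟨α, _, P, hP, h⟩ := h
  exact ⟨α, inferInstance, P, hP.mono hst, h⟩

/-- Splitting off the last block of variables. -/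
def splitEquiv (A α β : Type*) : (A × (α → Bool)) × (β → Bool) ≃ A × (α ⊕ β → Bool) :=
  (Equiv.prodAssoc _ _ _).trans
    ((Equiv.refl A).prodCongr (Equiv.sumArrowEquivProdArrow α β Bool).symm)

theorem IsExtendable.double {E k t : ℕ} (h : IsExtendable E k t) : IsExtendable E (2 * k) t := by
  obtain ⟨α, _, P, hP, ⟨q, hq⟩, hk⟩ := h
  refine ⟨α ⊕ Unit, inferInstance, fun p => P (p.1, p.2 ∘ Sum.inl), ?_,
    ⟨Sum.elim q fun _ => true, hq⟩, ?_⟩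
  · exact hP.comap (Sum.elim Sum.inl fun x => Sum.inr (Sum.inl x))
  · have : {p : (Fin E → Bool) × (α ⊕ Unit → Bool) |
        (∀ i, p.1 i = true) ∨ P (p.1, p.2 ∘ Sum.inl)} =
        splitEquiv _ _ _ '' ({p | (∀ i, p.1 i = true) ∨ P p} ×ˢ Set.univ) := by
      rw [Equiv.image_eq_preimage_symm]
      ext p
      simp [splitEquiv, Equiv.sumArrowEquivProdArrow, Function.comp_def]
    rw [this, Set.ncard_image_of_injective _ (Equiv.injective _), Set.ncard_prod, hk,
      Set.ncard_univ]
    simp [Nat.card_eq_fintype_card, mul_comm]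

/-- The new term fixes the distinguished variables from index `e` on to true, the old further
variables to `q` and the `e` new ones to true. Since `q` is untouched, it meets the old models only
where all distinguished variables are true, so it adds 2^e - 1 models. Setting the new variables to
false gives the next untouched assignment. -/
theorem IsExtendable.append_ones {E k t e : ℕ} (h : IsExtendable E k t) (he : 1 ≤ e)
    (heE : e ≤ E) : IsExtendable E (2 ^ e * k + (2 ^ e - 1)) (t + 1) := by
  obtain ⟨α, _, P, hP, ⟨q, hq⟩, hk⟩ := h
  refine ⟨α ⊕ Fin e, inferInstance, fun p => P (p.1, p.2 ∘ Sum.inl) ∨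
    ((∀ i, e ≤ i.val → p.1 i = true) ∧ p.2 = Sum.elim q fun _ => true), ?_,
    ⟨Sum.elim q fun _ => false, fun a => ?_⟩, ?_⟩
  · refine ((hP.comap (Sum.elim Sum.inl fun x => Sum.inr (Sum.inl x))).and
      (IsClause.hasCnf (P := fun v : Fin E ⊕ α ⊕ Fin e → Bool =>
        (∃ i : Fin E, e ≤ i.val ∧ v (.inl i) = false) ∨
        (∃ i : α, v (.inr (.inl i)) = !q i) ∨ ∃ i : Fin e, v (.inr (.inr i)) = false)
      ((IsClause.exists fun i => (IsClause.lit _ _).const_and _).or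
        ((IsClause.exists fun i => IsClause.lit _ _).or
          (IsClause.exists fun i => IsClause.lit _ _))))).congr fun v => ?_
    have h (b c : Bool) : b = !c ↔ ¬ b = c := by cases b <;> cases c <;> decide
    rw [not_or, not_and_or]
    refine and_congr Iff.rfl (or_congr (by simp) ?_)
    rw [funext_iff, Sum.forall, not_and_or]
    simp [h]
  · rw [not_or]
    refine ⟨hq a, fun h => ?_⟩
    have := congrFun h.2 (Sum.inr ⟨0, he⟩)
    simp at this
  · have hset : {p : (Fin E → Bool) × (α ⊕ Fin e → Bool) | (∀ i, p.1 i = true) ∨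
        (P (p.1, p.2 ∘ Sum.inl) ∨ ((∀ i, e ≤ i.val → p.1 i = true) ∧
          p.2 = Sum.elim q fun _ => true))} =
        splitEquiv _ _ _ '' ({p | (∀ i, p.1 i = true) ∨ P p} ×ˢ Set.univ) ∪
        (fun a => (a, Sum.elim q fun _ => true)) ''
          ({a | ∀ i : Fin E, e ≤ i.val → a i = true} \ {fun _ => true}) := by
      rw [Equiv.image_eq_preimage_symm]
      ext ⟨a, r⟩
      simp only [splitEquiv, Equiv.sumArrowEquivProdArrow, Set.mem_union, Set.mem_ofPred_eq,
        Set.mem_image, Set.mem_sdiff, Set.mem_singleton_iff, Prod.mk.injEq, funext_iff (α := Fin E)]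
      by_cases ha : ∀ i, a i = true
      · simp [ha]
      · simp only [ha, false_or]
        refine or_congr (by simp [Function.comp_def, ha]) ?_
        constructor
        · rintro ⟨h1, h2⟩
          exact ⟨a, ⟨h1, ha⟩, fun _ => rfl, h2.symm⟩
        · rintro ⟨a', ⟨h1, h2⟩, h3, h4⟩
          obtain rfl : a' = a := funext h3
          exact ⟨h1, h4.symm⟩
    rw [hset, Set.ncard_union_eq, Set.ncard_image_of_injective _ (Equiv.injective _),
      Set.ncard_prod, hk, Set.ncard_univ, Set.ncard_image_of_injective,
      Set.ncard_sdiff_singleton_of_mem, ncard_forall_true]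
    · simp [Nat.card_eq_fintype_card, mul_comm, Fin.card_filter_val_lt, heE]
    · simp
    · intro a b h
      exact (Prod.ext_iff.1 h).1
    · rw [Set.disjoint_left, Equiv.image_eq_preimage_symm]
      rintro _ h ⟨a, ⟨h1, h2⟩, rfl⟩
      rcases h.1 with h | h
      · exact h2 (funext h)
      · exact hq _ h

/-- The second claim collects trailing 1s while low bits are peeled off, so that a whole run costs
one term. There `2 * k + 1` stands for `k` followed by any positive number of 1s: the block count is
the same. -/
theorem isExtendable_blockCount (E k : ℕ) (hk : 1 ≤ k) :
    (k < 2 ^ E → IsExtendable E k (blockCount k)) ∧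
      ∀ e, 2 ^ e * k + (2 ^ e - 1) < 2 ^ E → 1 ≤ e →
        IsExtendable E (2 ^ e * k + (2 ^ e - 1)) (blockCount (2 * k + 1)) := by
  have hle (e k : ℕ) (hk : 1 ≤ k) (h : 2 ^ e * k + (2 ^ e - 1) < 2 ^ E) : e ≤ E := by
    refine (Nat.pow_le_pow_iff_right (a := 2) (by norm_num)).1 ?_
    have := Nat.le_mul_of_pos_right (2 ^ e) hk
    omega
  induction k using Nat.strong_induction_on with
  | _ k ih =>
    obtain ⟨y, rfl | rfl⟩ := Nat.even_or_odd' k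
    · have h1 : 2 * y < 2 ^ E → IsExtendable E (2 * y) (blockCount (2 * y)) := fun h => by
        rw [blockCount_two_mul]
        exact ((ih y (by omega) (by omega)).1 (by omega)).double
      refine ⟨h1, fun e he h1e => ?_⟩
      have h2 : 2 * y < 2 ^ E := by
        have := Nat.le_mul_of_pos_left (2 * y) (show 0 < 2 ^ e by positivity)
        omega
      rw [blockCount_two_mul_add_one, if_pos (by omega)]
      exact (h1 h2).append_ones h1e (hle e _ hk he)
    · rcases Nat.eq_zero_or_pos y with rfl | hy
      · refine ⟨fun _ => (isExtendable_one E).mono (Nat.zero_le _), fun e he h1e => ?_⟩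
        refine ((isExtendable_one E).append_ones h1e (hle e _ hk he)).mono ?_
        have h0 := blockCount_two_mul_add_one 0
        rw [blockCount_two_mul_add_one]
        simp_all
      · have ihy := (ih y (by omega) hy).2
        refine ⟨fun h => ?_, fun e he h1e => ?_⟩
        · simpa using ihy 1 (by simpa using h) le_rfl
        · have h1 : 1 ≤ 2 ^ e := Nat.one_le_two_pow
          have h2 : 2 ^ e * (2 * y + 1) + (2 ^ e - 1) = 2 ^ (e + 1) * y + (2 ^ (e + 1) - 1) := by
            rw [pow_succ, mul_add, mul_one, mul_assoc]
            omega
          rw [blockCount_two_mul_add_one, if_neg (by omega), add_zero, h2]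
          exact ihy (e + 1) (h2 ▸ he) (by omega)

theorem IsExtendable.exists_generates {E k t : ℕ} (h : IsExtendable E k t) (hk : k ≠ 0) :
    ∃ t' ≤ t + 1, Generates k t' := by
  obtain ⟨α, _, P, hP, -, h⟩ := h
  refine HasCnf.exists_generates_compl (α := Fin E ⊕ α) (P := fun v =>
    (∀ i, v (.inl i) = true) ∨ P (v ∘ Sum.inl, v ∘ Sum.inr)) ?_ hk ?_
  · refine (hP.and (IsClause.hasCnf (IsClause.exists fun i : Fin E =>
      IsClause.lit (Sum.inl i) false))).congr fun v => ?_
    rw [not_or, and_comm]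
    simp
  · rw [← h, ← Set.ncard_image_of_injective _ (Equiv.sumArrowEquivProdArrow _ _ Bool).injective,
      Equiv.image_eq_preimage_symm]
    rfl

theorem exists_generates_le_blockCount {k : ℕ} (hk : 1 ≤ k) :
    ∃ t ≤ blockCount k + 1, Generates k t :=
  ((isExtendable_blockCount k k hk).1 Nat.lt_two_pow_self).exists_generates (by omega)

/-! ### Sums of products from a selector CNF -/

theorem ncard_exists_lt_eq_false {n w : ℕ} (h : w ≤ n) :
    {z : Fin n → Bool | ∃ i, i.val < w ∧ z i = false}.ncard = 2 ^ n - 2 ^ (n - w) := by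
  have h1 := Set.ncard_add_ncard_compl {z : Fin n → Bool | ∀ i, i.val < w → z i = true}
  have h2 : {z : Fin n → Bool | ∀ i, i.val < w → z i = true}ᶜ =
      {z | ∃ i, i.val < w ∧ z i = false} := by
    ext z; simp
  rw [h2, ncard_forall_true, Finset.filter_not,
    Finset.card_sdiff_of_subset (Finset.filter_subset _ _)] at h1
  simp [Nat.card_eq_fintype_card, Fin.card_filter_val_lt, h] at h1
  omega

/-- The solutions are zero and the `y` whose highest true bit is a set bit of `c`, with 2^i of them
for each set bit i < r. -/
theorem ncard_top_bit (r c : ℕ) :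
    {y : Fin r → Bool | ∀ i : Fin r, (y i = false ∨ ∃ l, i < l ∧ y l = true) ∨
      c.testBit i = true}.ncard = c % 2 ^ r + 1 := by
  induction r with
  | zero => simp [Nat.mod_one, Set.ncard_univ]
  | succ r ih =>
    set A := {y : Fin r → Bool | ∀ i : Fin r, (y i = false ∨ ∃ l, i < l ∧ y l = true) ∨
      c.testBit i = true} with hA
    have hset : {y : Fin (r + 1) → Bool | ∀ i, (y i = false ∨ ∃ l, i < l ∧ y l = true) ∨
        c.testBit i = true} =
        (fun y => Fin.snoc (α := fun _ => Bool) y false) '' A ∪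
          (fun y => Fin.snoc (α := fun _ => Bool) y true) '' {_y | c.testBit r = true} := by
      ext y
      obtain ⟨y, b, rfl⟩ : ∃ y' b, y = Fin.snoc (α := fun _ => Bool) y' b :=
        ⟨Fin.init y, y (Fin.last r), (Fin.snoc_init_self y).symm⟩
      simp only [Set.mem_ofPred_eq, Set.mem_union, Set.mem_image, Fin.snoc_inj, hA,
        Fin.forall_fin_succ', Fin.exists_fin_succ', Fin.snoc_castSucc, Fin.snoc_last,
        Fin.castSucc_lt_castSucc_iff, Fin.castSucc_lt_last, Fin.val_castSucc, Fin.val_last]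
      cases b
      · simp [Fin.not_lt.2 (Fin.le_last _)]
      · simp [Fin.not_lt.2 (Fin.le_last _)]
    have hinj (b : Bool) :
        Function.Injective fun y : Fin r → Bool => Fin.snoc (α := fun _ => Bool) y b :=
      fun y y' h => (Fin.snoc_inj.1 h).1
    rw [hset, Set.ncard_union_eq, Set.ncard_image_of_injective _ (hinj _), ih,
      Set.ncard_image_of_injective _ (hinj _)]
    · rw [Nat.mod_pow_succ, ← Nat.toNat_testBit]
      cases c.testBit r
      · simp
      · simp [Set.ncard_univ]
        omega
    · rw [Set.disjoint_left]
      rintro _ ⟨y, -, rfl⟩ ⟨y', -, h⟩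
      simpa using (Fin.snoc_inj.1 h).2

theorem ncard_fibers {X Y J : Type*} [Finite X] [Fintype J] (code : J → Y)
    (hcode : Function.Injective code) (S : J → Set X) :
    {p : X × Y | ∃ j, p.2 = code j ∧ p.1 ∈ S j}.ncard = ∑ j, (S j).ncard := by
  have h : {p : X × Y | ∃ j, p.2 = code j ∧ p.1 ∈ S j} =
      Set.range fun q : Σ j, S j => ((q.2 : X), code q.1) := by
    ext ⟨x, y⟩
    constructor
    · rintro ⟨j, rfl, hx⟩
      exact ⟨⟨j, x, hx⟩, rfl⟩
    · rintro ⟨⟨j, x, hx⟩, h⟩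
      obtain ⟨rfl, rfl⟩ := Prod.mk.inj h
      exact ⟨j, rfl, hx⟩
  rw [h, ← Nat.card_coe_set_eq, Nat.card_range_of_injective, Nat.card_sigma]
  · simp
  · rintro ⟨j, x, hx⟩ ⟨j', x', hx'⟩ h
    obtain ⟨h1, h2⟩ := Prod.mk.inj h
    obtain rfl := hcode h2
    simp only at h1
    subst h1
    rfl

/-- `s` marks a single position `j` and `t` is the indicator of the positions up to `j`. -/
def IsSelector {m : ℕ} (s t : Fin (m + 1) → Bool) : Prop :=
  (∃ j, s j = true) ∧ (∀ j, s j = false ∨ t j = true) ∧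
    (∀ i : Fin m, s i.castSucc = false ∨ t i.succ = false) ∧
    ∀ i : Fin m, t i.succ = false ∨ t i.castSucc = true

/-- The implications make `t` antitone, and any marked `j` forces `t` to end exactly at `j`; hence
the mark is unique. This achieves one-hotness with linearly many clauses. -/
theorem isSelector_iff {m : ℕ} (s t : Fin (m + 1) → Bool) :
    IsSelector s t ↔ ∃ j, (s, t) = ((fun i => decide (i = j)), fun i => decide (i ≤ j)) := by
  constructor
  · rintro ⟨⟨j, hj⟩, h1, h2, h3⟩
    have hanti : Antitone t := Fin.antitone_iff_succ_le.2 fun i => by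
      rcases h3 i with h | h <;> simp [h]
    have ht (j) (hj : s j = true) : t = fun i => decide (i ≤ j) := by
      have h1j : t j = true := (h1 j).resolve_left (by simp [hj])
      ext i
      rcases le_or_gt i j with hi | hi
      · have := hanti hi
        rw [h1j] at this
        simpa [hi] using top_le_iff.1 this
      · obtain ⟨j', rfl⟩ : ∃ j' : Fin m, j = j'.castSucc :=
          ⟨j.castPred (Fin.ne_last_of_lt hi), by simp⟩
        have h2j : t j'.succ = false := (h2 j').resolve_left (by simp [hj])
        have := hanti (Fin.castSucc_lt_iff_succ_le.1 hi)
        rw [h2j] at this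
        simpa [not_le.2 hi] using le_bot_iff.1 this
    refine ⟨j, Prod.ext (funext fun i => ?_) (ht j hj)⟩
    by_cases hi : s i = true
    · have h := (ht i hi).symm.trans (ht j hj)
      have a := congrFun h i
      have b := congrFun h j
      have : i = j := le_antisymm (by simpa using a) (by simpa using b)
      simp [this, hj]
    · have : i ≠ j := fun h => hi (h ▸ hj)
      simpa [this] using hi
  · rintro ⟨j, h⟩
    obtain ⟨rfl, rfl⟩ := Prod.mk.inj h
    refine ⟨⟨j, by simp⟩, fun i => ?_, fun i => ?_, fun i => ?_⟩
    · by_cases h : i = j <;> simp [h]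
    · by_cases h : i.castSucc = j
      · simp [← h]
      · simp [h]
    · by_cases h : i.succ ≤ j
      · simp [(Fin.castSucc_lt_succ).le.trans h]
      · simp [h]

/-- The clause for bit `i` of `y` lists every `s j` for which `c j` has that bit, so all factors `c
j + 1` share `r` clauses. Each `j < m` has one clause on `z`, the last class has none, and the
selector takes 3m + 2. -/
theorem exists_hasCnf_sum (r Z m : ℕ) (c : Fin (m + 1) → ℕ) (w : Fin m → ℕ)
    (hc : ∀ j, c j < 2 ^ r) (hw : ∀ j, w j ≤ Z) :
    ∃ t' ≤ r + 4 * m + 2, Generates ((c (Fin.last m) + 1) * 2 ^ Z +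
      ∑ j : Fin m, (c j.castSucc + 1) * (2 ^ Z - 2 ^ (Z - w j))) t' := by
  let PY (y : Fin r → Bool) (s : Fin (m + 1) → Bool) : Prop :=
    ∀ i, (y i = false ∨ ∃ l, i < l ∧ y l = true) ∨ ∃ j, (c j).testBit i = true ∧ s j = true
  let PZ (z : Fin Z → Bool) (s : Fin (m + 1) → Bool) : Prop :=
    ∀ j : Fin m, s j.castSucc = false ∨ ∃ i : Fin Z, i.val < w j ∧ z i = false
  refine HasCnf.exists_generates (α := (Fin r ⊕ Fin Z) ⊕ (Fin (m + 1) ⊕ Fin (m + 1)))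
    (P := fun v => (PY (v ∘ Sum.inl ∘ Sum.inl) (v ∘ Sum.inr ∘ Sum.inl) ∧
      PZ (v ∘ Sum.inl ∘ Sum.inr) (v ∘ Sum.inr ∘ Sum.inl)) ∧
      IsSelector (v ∘ Sum.inr ∘ Sum.inl) (v ∘ Sum.inr ∘ Sum.inr)) ?_ (by omega) ?_
  · refine (((HasCnf.forall fun i => ?_).and (HasCnf.forall fun i => ?_)).and
      ((IsClause.hasCnf ?_).and ((HasCnf.forall fun i => ?_).and
        ((HasCnf.forall fun i => ?_).and (HasCnf.forall fun i => ?_))))).mono ?_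
    · exact ((IsClause.lit _ _).or (.exists fun i => (IsClause.lit _ _).const_and _)).or
        (.exists fun i => (IsClause.lit _ _).const_and _)
    · exact (IsClause.lit _ _).or (.exists fun i => (IsClause.lit _ _).const_and _)
    · exact .exists fun i => IsClause.lit _ _
    · exact (IsClause.lit _ _).or (IsClause.lit _ _)
    · exact (IsClause.lit _ _).or (IsClause.lit _ _)
    · exact (IsClause.lit _ _).or (IsClause.lit _ _)
    · simp only [Fintype.card_fin]
      omega
  · let φ := (Equiv.sumArrowEquivProdArrow (Fin r ⊕ Fin Z) (Fin (m + 1) ⊕ Fin (m + 1)) Bool).trans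
      ((Equiv.sumArrowEquivProdArrow (Fin r) (Fin Z) Bool).prodCongr
        (Equiv.sumArrowEquivProdArrow (Fin (m + 1)) (Fin (m + 1)) Bool))
    let code (j : Fin (m + 1)) : (Fin (m + 1) → Bool) × (Fin (m + 1) → Bool) :=
      ((fun i => decide (i = j)), fun i => decide (i ≤ j))
    have hcode : Function.Injective code := fun j j' h => by
      have := congrFun (Prod.mk.inj h).1 j
      simpa using this
    have key := ncard_fibers code hcode fun j =>
      {y | PY y (code j).1} ×ˢ {z | PZ z (code j).1}
    rw [← Set.ncard_image_of_injective _ φ.injective, Equiv.image_eq_preimage_symm]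
    trans
    · convert key using 2
      ext ⟨⟨y, z⟩, s, t⟩
      change (PY y s ∧ PZ z s) ∧ IsSelector s t ↔ _
      rw [isSelector_iff]
      constructor
      · rintro ⟨h, j, hj⟩
        obtain ⟨rfl, rfl⟩ := Prod.mk.inj hj
        exact ⟨j, rfl, h⟩
      · rintro ⟨j, hj, h⟩
        obtain ⟨rfl, rfl⟩ := Prod.mk.inj hj
        exact ⟨h, j, rfl⟩
    · have hY (j) : {y | PY y (code j).1}.ncard = c j + 1 := by
        rw [← Nat.mod_eq_of_lt (hc j), ← ncard_top_bit]
        congr 1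
        ext y
        simp [PY, code]
      have hZ (j : Fin m) : {z | PZ z (code j.castSucc).1}.ncard = 2 ^ Z - 2 ^ (Z - w j) := by
        rw [← ncard_exists_lt_eq_false (hw j)]
        congr 1
        ext z
        simp only [PZ, code, Set.mem_ofPred_eq]
        constructor
        · intro h
          simpa using h j
        · intro h i
          by_cases hi : i = j
          · exact Or.inr (hi ▸ h)
          · simp [hi]
      have hZl : {z | PZ z (code (Fin.last m)).1}.ncard = 2 ^ Z := by
        have : {z | PZ z (code (Fin.last m)).1} = Set.univ := by
          ext z
          simp [PZ, code, (Fin.castSucc_lt_last _).ne]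
        rw [this, Set.ncard_univ]
        simp [Nat.card_eq_fintype_card]
      rw [key, Fin.sum_univ_castSucc, add_comm]
      simp only [Set.ncard_prod, hY, hZ, hZl]

/-! ### The square-root bound -/

theorem sum_digits_eq_mod (b x m : ℕ) :
    ∑ j ∈ Finset.range m, (x / b ^ j % b) * b ^ j = x % b ^ m := by
  induction m with
  | zero => simp [Nat.mod_one]
  | succ m ih => rw [Finset.sum_range_succ, ih, Nat.mod_pow_succ, mul_comm (b ^ m)]

theorem sum_pow_le {b : ℕ} (hb : 2 ≤ b) (m : ℕ) : ∑ j ∈ Finset.range m, b ^ j ≤ b ^ m := by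
  induction m with
  | zero => simp
  | succ m ih =>
    rw [Finset.sum_range_succ, pow_succ]
    have := Nat.mul_le_mul_left (b ^ m) hb
    omega

theorem exists_generates_le_sqrt {k : ℕ} (hk : 16 ≤ k) :
    ∃ t ≤ 8 * Nat.sqrt (Nat.log 2 k), Generates k t := by
  have hN : 4 ≤ Nat.log 2 k :=
    Nat.le_log_of_pow_le (by norm_num) (by simpa using hk)
  have hq : 2 ≤ Nat.sqrt (Nat.log 2 k) := Nat.le_sqrt.2 (by omega)
  obtain ⟨p, hp⟩ := Nat.exists_eq_add_of_le' hq
  -- These bounds are 2^((p+2)^2) ≤ k < 2^((p+3)^2), with (p+2)p split off the exponents.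
  have hlo : 2 ^ ((p + 2) * p + (2 * p + 4)) ≤ k := by
    refine le_trans (Nat.pow_le_pow_right (by norm_num) ?_) (Nat.pow_log_le_self 2 (by omega))
    have := Nat.sqrt_le (Nat.log 2 k)
    rw [hp] at this
    linarith
  have hhi : k < 2 ^ ((p + 2) * p + (4 * p + 9)) := by
    refine lt_of_lt_of_le (Nat.lt_pow_succ_log_self (b := 2) (by norm_num) k)
      (Nat.pow_le_pow_right (by norm_num) ?_)
    have := Nat.lt_succ_sqrt (Nat.log 2 k)
    rw [hp, Nat.succ_eq_add_one] at this
    rw [Nat.succ_eq_add_one]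
    linarith
  rw [hp]
  set b := 2 ^ (p + 2) with hb
  have hb2 : 2 ≤ b := by
    rw [hb]; exact Nat.le_self_pow (by omega) 2
  have hbp : b ^ p = 2 ^ ((p + 2) * p) := by rw [hb, pow_mul]
  set M := 2 ^ ((p + 2) * p) with hM
  have hM0 : 0 < M := by positivity
  rw [pow_add, ← hM] at hlo hhi
  set S := ∑ j ∈ Finset.range p, b ^ j with hS
  have hSle : S ≤ M := by rw [← hbp]; exact sum_pow_le hb2 p
  -- Rounding k + S up to a multiple of M; S supplies the +1 in each coefficient. With base-b digits
  -- d_j of x, x + S = Σ (d_j+1) b^j, so k = (A - D) M + Σ (d_j+1)(M - b^j).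
  obtain ⟨x, hx, A, hA⟩ : ∃ x < M, ∃ A, k + (x + S) = A * M := by
    have hlt := Nat.mod_lt (k + S) hM0
    have hdiv := Nat.div_add_mod (k + S) M
    rcases Nat.eq_zero_or_pos ((k + S) % M) with h | h
    · exact ⟨0, hM0, (k + S) / M, by rw [mul_comm]; omega⟩
    · exact ⟨M - (k + S) % M, by omega, (k + S) / M + 1, by
        rw [add_mul, mul_comm ((k + S) / M)]; omega⟩
  let d (j : ℕ) : ℕ := x / b ^ j % b
  have hd (j : ℕ) : d j < b := Nat.mod_lt _ (by omega)
  have hsum : ∑ j ∈ Finset.range p, (d j + 1) * b ^ j = x + S := by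
    simp only [add_mul, one_mul, Finset.sum_add_distrib, d]
    rw [sum_digits_eq_mod, hbp, Nat.mod_eq_of_lt hx]
  set D := ∑ j ∈ Finset.range p, (d j + 1) with hD
  have hDle : D ≤ p * b := by
    simpa using Finset.sum_le_card_nsmul (Finset.range p) (fun j => d j + 1) b fun j _ => hd j
  have hDA : D + 1 ≤ A := by
    have h1 : 2 ^ (2 * p + 4) ≤ A := by
      refine Nat.le_of_mul_le_mul_left ?_ hM0
      rw [mul_comm M A]
      omega
    have h2 : 2 ^ (2 * p + 4) = 2 ^ p * b * 4 := by
      rw [hb, show 2 * p + 4 = p + (p + 2) + 2 by ring, pow_add, pow_add]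
      norm_num
    have h3 : p * b ≤ 2 ^ p * b := Nat.mul_le_mul_right _ Nat.lt_two_pow_self.le
    have h4 : 1 ≤ 2 ^ p * b := Nat.one_le_iff_ne_zero.2 (by positivity)
    omega
  have hAle : A ≤ 2 ^ (4 * p + 10) := by
    have h1 : 2 ^ (4 * p + 10) = 2 ^ (4 * p + 9) * 2 := pow_succ _ _
    have h2 : 2 ≤ 2 ^ (4 * p + 9) := Nat.le_self_pow (by omega) 2
    refine Nat.le_of_mul_le_mul_left ?_ hM0
    have h3 := Nat.mul_le_mul_left M h2
    rw [h1, mul_comm M A, ← mul_assoc]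
    omega
  -- The widths make 2^(Z - w_j) = b^j for Z = (p+2)p. The clause count is (4p+10) + 4p + 2 ≤
  -- 8(p+2).
  obtain ⟨t, ht, h⟩ := exists_hasCnf_sum (4 * p + 10) ((p + 2) * p) p
    (fun j => if j.val < p then d j else A - D - 1) (fun j => (p + 2) * p - (p + 2) * j)
    (fun j => by
      split_ifs
      · refine (hd j).trans_le (Nat.pow_le_pow_right (by norm_num) (by omega))
      · omega)
    (fun j => Nat.sub_le _ _)
  refine ⟨t, by omega, ?_⟩
  convert h using 1
  have hterm (j : Fin p) : 2 ^ ((p + 2) * p - ((p + 2) * p - (p + 2) * (j : ℕ))) = b ^ (j : ℕ) := by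
    rw [Nat.sub_sub_self (Nat.mul_le_mul_left _ j.2.le), pow_mul]
  have hle (j : ℕ) (hj : j ∈ Finset.range p) : b ^ j ≤ M := by
    rw [← hbp]
    exact Nat.pow_le_pow_right (by omega) (Finset.mem_range.1 hj).le
  simp only [hterm, Fin.val_castSucc, Fin.is_lt, if_true, Fin.val_last, lt_irrefl, if_false, ← hM]
  rw [Fin.sum_univ_eq_sum_range (fun j => (d j + 1) * (M - b ^ j)) p]
  have hprod : ∑ j ∈ Finset.range p, (d j + 1) * (M - b ^ j) + (x + S) = D * M := by
    rw [← hsum, ← Finset.sum_add_distrib, hD, Finset.sum_mul]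
    refine Finset.sum_congr rfl fun j hj => ?_
    rw [← mul_add, Nat.sub_add_cancel (hle j hj)]
  obtain ⟨a, rfl⟩ := Nat.exists_eq_add_of_le hDA
  rw [show D + 1 + a - D - 1 + 1 = a + 1 by omega]
  have : (D + 1 + a) * M = D * M + (a + 1) * M := by ring
  omega

/-! ### Assembling the bounds -/

theorem beta_le_of_exists {k T : ℕ} (h : ∃ t ≤ T, Generates k t) : beta k ≤ T := by
  obtain ⟨t, ht, h⟩ := h
  exact (Nat.sInf_le h).trans ht

theorem blockCount_le_two {k : ℕ} (hk : k < 16) : blockCount k ≤ 2 := by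
  interval_cases k <;> decide

end ModelCounting

theorem theorem1 (k : ℕ) (hk : 3 ≤ k) :
    Real.logb 2 ((ModelCounting.blockCount k : ℝ) + 1) ≤ (ModelCounting.beta k : ℝ) ∧
      (ModelCounting.beta k : ℝ) ≤
        min (20 * Real.sqrt (Real.logb 2 (k : ℝ)) * Real.logb 2 (Real.logb 2 (k : ℝ)))
          ((ModelCounting.blockCount k : ℝ) + 1) := by
  open ModelCounting in
  have hblock := exists_generates_le_blockCount (k := k) (by omega)
  have hbeta : beta k ≤ blockCount k + 1 := beta_le_of_exists hblock
  refine ⟨?_, le_min ?_ (by exact_mod_cast hbeta)⟩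
  · obtain ⟨t, -, ht⟩ := hblock
    have hlt := blockCount_lt_of_generates (Nat.sInf_mem (s := {t | Generates k t}) ⟨t, ht⟩)
    rw [Real.logb_le_iff_le_rpow (by norm_num) (by positivity), Real.rpow_natCast]
    exact_mod_cast hlt
  -- For k < 16 the block bound gives at most 3, while the right-hand side is at least 20 · 1 · 1/2.
  · rcases lt_or_ge k 16 with h16 | h16
    · have h3 : (beta k : ℝ) ≤ 3 := by
        have := blockCount_le_two h16
        exact_mod_cast (by omega : beta k ≤ 3)
      have hL : (3 / 2 : ℝ) ≤ Real.logb 2 k := by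
        rw [Real.le_logb_iff_rpow_le (by norm_num) (by positivity)]
        refine le_trans ?_ (show (3 : ℝ) ≤ k by exact_mod_cast hk)
        refine le_of_sq_le_sq ?_ (by norm_num)
        rw [← Real.rpow_natCast, ← Real.rpow_mul (by norm_num)]
        norm_num
      have hLL : (1 / 2 : ℝ) ≤ Real.logb 2 (Real.logb 2 k) := by
        rw [Real.le_logb_iff_rpow_le (by norm_num) (by linarith)]
        refine le_trans ?_ hL
        rw [← Real.sqrt_eq_rpow]
        exact Real.sqrt_le_iff.2 (by norm_num)
      have hs : 1 ≤ Real.sqrt (Real.logb 2 k) := Real.one_le_sqrt.2 (by linarith)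
      nlinarith
    · have hb := beta_le_of_exists (exists_generates_le_sqrt h16)
      have hL : (Nat.log 2 k : ℝ) ≤ Real.logb 2 k := by
        exact_mod_cast Real.natLog_le_logb k 2
      have hL2 : (2 : ℝ) ≤ Real.logb 2 k := by
        rw [Real.le_logb_iff_rpow_le (by norm_num) (by positivity)]
        norm_num
        exact_mod_cast (by omega : 4 ≤ k)
      have hLL : 1 ≤ Real.logb 2 (Real.logb 2 k) := by
        rw [Real.le_logb_iff_rpow_le (by norm_num) (by linarith)]
        simpa using hL2
      have hs : ((Nat.sqrt (Nat.log 2 k) : ℕ) : ℝ) ≤ Real.sqrt (Real.logb 2 k) :=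
        Real.nat_sqrt_le_real_sqrt.trans (Real.sqrt_le_sqrt hL)
      have hb' : (beta k : ℝ) ≤ 8 * (Nat.sqrt (Nat.log 2 k) : ℕ) := by exact_mod_cast hb
      have hs0 := Real.sqrt_nonneg (Real.logb 2 k)
      nlinarith
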